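/- Let $K$ be a field of characteristic zero, let $x = (x_1,\dots,x_n)$ and $y = (y_1,\dots,y_n)$ be two independent tuples of indeterminates, and let $H = (H_1,\dots,H_n) \in K[x]^n$. Suppose that $x+H$ is a quasi-translation, i.e. that the polynomial map $x+H$ is invertible with inverse $x-H$. Let $\mathcal{J}H = (\partial H_i/\partial x_j)_{i,j}$ be the Jacobian matrix of $H$, let $\operatorname{rk}\mathcal{J}H$ be its rank over the field $K(x)$, and let $\deg H = \max_i \deg H_i$ (total degree). If $\deg H = 1$ or $\operatorname{rk}\mathcal{J}H = 1$, then $\mathcal{J}H$ has strong nilpotency index two. That is, the least $r \in \mathbb{N}$ such that $$\mathcal{J}H|_{x=y^{(1)}} \cdot \mathcal{J}H|_{x=y^{(2)}} \cdots \mathcal{J}H|_{x=y^{(r)}} = 0,$$ where $y^{(1)},\dots,y^{(r)}$ are independent $n$-tuples of indeterminates, is $r = 2$. In particular $$\mathcal{J}H \cdot \mathcal{J}H|_{x=y} = 0 \quad\text{over } K[x,y].$$ -/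

import Mathlib

namespace QuasiTrans

/-- A polynomial map in dimension `n` over `R`, given by its `n` coordinate polynomials. -/
abbrev PolyMap (n : ℕ) (R : Type*) [CommRing R] : Type _ :=
  Fin n → MvPolynomial (Fin n) R

/-- The identity polynomial map `x = (x₁, …, xₙ)`. -/
noncomputable def idMap (n : ℕ) (R : Type*) [CommRing R] : PolyMap n R :=
  fun i => MvPolynomial.X i

/-- The composition `F ∘ G`, whose coordinates are `Fᵢ(G₁, …, Gₙ)`. -/
noncomputable def comp {n : ℕ} {R : Type*} [CommRing R] (F G : PolyMap n R) : PolyMap n R :=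
  fun i => MvPolynomial.bind₁ G (F i)

/-- `x + H` is a quasi-translation: it is invertible with (two-sided) inverse `x - H`. -/
def IsQuasiTranslation {n : ℕ} {R : Type*} [CommRing R] (H : PolyMap n R) : Prop :=
  comp (idMap n R + H) (idMap n R - H) = idMap n R ∧
    comp (idMap n R - H) (idMap n R + H) = idMap n R

/-- The Jacobian matrix, with `(i, j)` entry `∂Hᵢ/∂xⱼ`. -/
noncomputable def jacobian {n : ℕ} {R : Type*} [CommRing R] (H : PolyMap n R) :
    Matrix (Fin n) (Fin n) (MvPolynomial (Fin n) R) :=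
  Matrix.of fun i j => MvPolynomial.pderiv j (H i)

/-- The degree of a polynomial map: the maximum of the total degrees of its coordinates. -/
def degree {n : ℕ} {R : Type*} [CommRing R] (H : PolyMap n R) : ℕ :=
  Finset.univ.sup fun i => (H i).totalDegree

/-- The rank of a polynomial matrix over a field `K`: its rank over the field of rational
functions `K(x₁, …, xₙ)`. -/
noncomputable def polyRank {m n : ℕ} {K : Type*} [Field K]
    (M : Matrix (Fin m) (Fin m) (MvPolynomial (Fin n) K)) : ℕ :=
  (M.map (algebraMap (MvPolynomial (Fin n) K)
    (FractionRing (MvPolynomial (Fin n) K)))).rank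

/-- The product `M|_{x = y⁽¹⁾} * M|_{x = y⁽²⁾} * ⋯ * M|_{x = y⁽ʳ⁾}`, where the
`y⁽ᵏ⁾ = (y⁽ᵏ⁾₁, …, y⁽ᵏ⁾ₙ)` are `r` independent tuples of indeterminates; the variable `(k, j)`
stands for `y⁽ᵏ⁾ⱼ`. -/
noncomputable def substProd {m n : ℕ} {R : Type*} [CommRing R]
    (M : Matrix (Fin m) (Fin m) (MvPolynomial (Fin n) R)) (r : ℕ) :
    Matrix (Fin m) (Fin m) (MvPolynomial (Fin r × Fin n) R) :=
  (List.ofFn fun k : Fin r => M.map (MvPolynomial.rename fun j : Fin n => (k, j))).prod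

/-- `M` is strongly nilpotent and its strong nilpotency index, the least `r` for which the product
of `r` independent substitution instances of `M` vanishes, equals `r`. -/
def HasStrongNilpotencyIndex {m n : ℕ} {R : Type*} [CommRing R]
    (M : Matrix (Fin m) (Fin m) (MvPolynomial (Fin n) R)) (r : ℕ) : Prop :=
  IsLeast {s : ℕ | substProd M s = 0} r

end QuasiTrans

/-!
Over a field of characteristic zero, a quasi-translation `x + H` satisfies `H(x + tH) = H` for an
indeterminate `t`, hence `JH(x) · H(x) = 0` (`IsQuasiTranslation.jacobian_mul_self`). It suffices to
strengthen this to `JH(x) · H(y) = 0` for an independent tuple `y`, since differentiating with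
respect to `y` then gives `JH(x) · JH(y) = 0`. If `deg H = 1`, then `JH` is constant, so there is
nothing to do.

If `JH` has rank one, the gradients of all `Hₗ` are proportional to that of some `g = Hₖ` that is
not constant, so every `Hₗ` is algebraic over `K[g]` (`isAlgebraic_of_pderiv_proportional`).
Morally, every `Hₗ` is a polynomial in one `f`, and `f(x) - f(y)` is the prime factor `Q(x, y)` of
`g(x) - g(y)` that vanishes on the diagonal `x = y`. The proof works with `Q` directly instead of
appealing to a theorem of Lüroth type:

* `Q` divides `Hₗ(x) - Hₗ(y)` for every `l` (`dvd_sub_of_isAlgebraic`);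
* therefore the derivation `∑ⱼ Hⱼ(y) ∂/∂xⱼ` maps `Q` to a multiple of `Q`, and it kills `Q` because
  it lowers the `x`-degree;
* the derivations `∂ᵢg(x) ∂/∂xⱼ - ∂ⱼg(x) ∂/∂xᵢ` also map `Q` to a multiple of `Q`, and they kill `Q`
  because the leading form of `Q` with respect to `y` does not involve `x`.

The last item says that the `x`-gradient of `Q` is proportional to that of `g(x)`, and the second
that it is orthogonal to `H(y)`. Hence `∑ⱼ Hⱼ(y) ∂g/∂xⱼ = 0`, and by proportionality the same holds
with `g` replaced by any `Hₗ` (`sum_pderiv_inl_mul_inr_eq_zero`).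
-/

namespace QuasiTrans

open MvPolynomial

/-! ### Derivations and algebraic dependence -/

/-- A field of characteristic zero is formally étale over a polynomial ring on a transcendence
basis. If that basis contains `h`, the partial derivative along `h` therefore extends to the
field. -/
theorem exists_derivation_eq_one {R F : Type*} [CommRing R] [IsDomain R] [CharZero R] [Field F]
    [Algebra R F] {h : F} (hh : Transcendental R h) : ∃ δ : Derivation R F F, δ h = 1 := by
  classical
  have hind : AlgebraicIndepOn R id ({h} : Set F) :=
    (algebraicIndependent_singleton_iff (R := R) (⟨h, rfl⟩ : ({h} : Set F))).2 hh
  obtain ⟨t, hst, ht⟩ := exists_isTranscendenceBasis_superset hind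
  let B := MvPolynomial t R
  let f : B →ₐ[R] F := aeval (fun i : t => (i : F))
  let _ : Algebra B F := f.toAlgebra
  have : IsScalarTower R B F := IsScalarTower.of_algebraMap_eq fun r => (f.commutes r).symm
  have : FaithfulSMul B F := (faithfulSMul_iff_algebraMap_injective B F).2 ht.1
  let _ : Algebra (FractionRing B) F := FractionRing.liftAlgebra B F
  have : IsScalarTower B (FractionRing B) F := FractionRing.isScalarTower_liftAlgebra B F
  have halgB : Algebra.IsAlgebraic B F := by
    have := ht.isAlgebraic
    exact Algebra.IsAlgebraic.of_ringHom_of_comp_eq ht.1.aevalEquiv (RingHom.id F)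
      ht.1.aevalEquiv.surjective Function.injective_id rfl
  have halg : Algebra.IsAlgebraic (FractionRing B) F :=
    ⟨fun x => (IsFractionRing.isAlgebraic_iff B (FractionRing B) F).1 (halgB.isAlgebraic x)⟩
  have : CharZero B := inferInstance
  have : CharZero (FractionRing B) := inferInstance
  have : Algebra.FormallyEtale (FractionRing B) F := Algebra.FormallyEtale.of_isSeparable _ _
  have : Algebra.FormallyEtale B (FractionRing B) :=
    Algebra.FormallyEtale.of_isLocalization (nonZeroDivisors B)
  have : Algebra.FormallyEtale B F := Algebra.FormallyEtale.comp B (FractionRing B) F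
  let i : t := ⟨h, hst rfl⟩
  let d : Derivation R B F := mkDerivation R (Pi.single i 1)
  let e := KaehlerDifferential.tensorKaehlerEquivOfFormallyEtale R B F
  let l : Ω[F⁄R] →ₗ[F] F := (LinearMap.liftBaseChange F d.liftKaehlerDifferential) ∘ₗ
    e.symm.toLinearMap
  refine ⟨l.compDer (KaehlerDifferential.D R F), ?_⟩
  have hX : algebraMap B F (X i) = h :=
    aeval_X (fun i : t => (i : F)) i
  have := KaehlerDifferential.tensorKaehlerEquivOfFormallyEtale_symm_D_algebraMap R B F (X i)
  rw [hX] at this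
  have hd : d (X i) = 1 := by
    rw [show d (X i) = (Pi.single i 1 : t → F) i from mkDerivation_X _ _ _, Pi.single_eq_same]
  simp [l, e, this, hd]

/-- The chain rule for a derivation. -/
theorem derivation_aeval_eq_sum {σ R B M : Type*} [Fintype σ] [CommRing R] [CommRing B]
    [Algebra R B] [AddCommGroup M] [Module B M] [Module R M] [IsScalarTower R B M]
    (D : Derivation R B M) (f : σ → B) (p : MvPolynomial σ R) :
    D (aeval f p) = ∑ i, aeval f (pderiv i p) • D (f i) := by
  classical
  induction p using MvPolynomial.induction_on with
  | C a => simp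
  | add p q hp hq => simp [hp, hq, add_smul, Finset.sum_add_distrib]
  | mul_X p j hp =>
    have : ∑ i, (aeval f p * (Pi.single i (1 : B) : σ → B) j) • D (f i) = aeval f p • D (f j) := by
      rw [Finset.sum_eq_single j] <;> simp +contextual [eq_comm]
    simp only [map_mul, Derivation.leibniz, hp, pderiv_X, aeval_X, smul_eq_mul, map_add,
      add_smul, Finset.sum_add_distrib, Finset.smul_sum, smul_smul]
    rw [← this]
    congr 1
    refine Finset.sum_congr rfl fun i _ => ?_
    by_cases h : i = j
    · subst h; simp
    · simp [Ne.symm h]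

theorem transcendental_of_pderiv_ne_zero {σ K : Type*} [Field K] [CharZero K]
    {g : MvPolynomial σ K} {i : σ} (hg : pderiv i g ≠ 0) : Transcendental K g := by
  intro h
  have hi := h.isIntegral
  have hsep : (minpoly K g).Separable := (minpoly.irreducible hi).separable
  -- Differentiating `minpoly g = 0` gives `(minpoly)'(g) * ∂g = 0`, and `(minpoly)'(g)` is a unit.
  obtain ⟨a, b, hab⟩ := hsep
  have h1 := congrArg (Polynomial.aeval g) hab
  have h2 := congrArg (pderiv i) (minpoly.aeval K g)
  rw [Derivation.map_aeval, map_zero, smul_eq_mul] at h2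
  simp only [map_add, map_mul, minpoly.aeval, mul_zero, zero_add, map_one] at h1
  apply hg
  linear_combination (-pderiv i g) * h1 + Polynomial.aeval g b * h2

/-- The Jacobian criterion for two polynomials: if the gradients of `g` and `h` are proportional
and `∂g/∂xᵢ ≠ 0`, then `h` is algebraic over `K[g]`. Otherwise some `K[g]`-derivation `δ` of the
rational function field has `δ h = 1`; but `δ` vanishes on `g`, hence, by the chain rule and
proportionality, also on `h`. -/
theorem isAlgebraic_of_pderiv_proportional {σ K : Type*} [Fintype σ] [Field K] [CharZero K]
    {g h : MvPolynomial σ K} {i : σ} (hg : pderiv i g ≠ 0)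
    (hgh : ∀ j, pderiv i g * pderiv j h = pderiv j g * pderiv i h) :
    ∃ p : Polynomial (Polynomial K), p ≠ 0 ∧
      p.eval₂ (Polynomial.aeval g : Polynomial K →ₐ[K] MvPolynomial σ K).toRingHom h = 0 := by
  let A := MvPolynomial σ K
  let _ : Algebra (Polynomial K) A := (Polynomial.aeval g).toAlgebra
  let F := FractionRing A
  suffices IsAlgebraic (Polynomial K) h by
    obtain ⟨p, hp0, hp⟩ := this
    exact ⟨p, hp0, hp⟩
  rw [← isAlgebraic_algebraMap_iff (IsFractionRing.injective A F)]
  by_contra htr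
  obtain ⟨δ, hδ⟩ := exists_derivation_eq_one htr
  have : IsScalarTower K (Polynomial K) A := IsScalarTower.of_algebraMap_eq fun r =>
    ((Polynomial.aeval g).commutes r).symm
  have : IsScalarTower K (Polynomial K) F := IsScalarTower.of_algebraMap_eq fun r => by
    rw [IsScalarTower.algebraMap_apply K A F, IsScalarTower.algebraMap_apply K (Polynomial K) A,
      ← IsScalarTower.algebraMap_apply (Polynomial K) A F]
  have chain (p : A) : δ (algebraMap A F p) =
      ∑ j, algebraMap A F (pderiv j p) * δ (algebraMap A F (X j)) := by
    have hev (q : A) : aeval (fun j => algebraMap A F (X j)) q = algebraMap A F q := by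
      have : aeval (fun j => algebraMap A F (X j)) = IsScalarTower.toAlgHom K A F := by
        ext j; exact aeval_X _ _
      exact DFunLike.congr_fun this q
    simpa [hev] using derivation_aeval_eq_sum (δ.restrictScalars K)
      (fun j => algebraMap A F (X j)) p
  have hgX : algebraMap A F g = algebraMap (Polynomial K) F Polynomial.X := by
    rw [IsScalarTower.algebraMap_apply (Polynomial K) A F]
    congr 1
    exact (Polynomial.aeval_X g).symm
  have hδg : δ (algebraMap A F g) = 0 := by rw [hgX, δ.map_algebraMap]
  rw [chain] at hδ hδg
  apply hg
  apply IsFractionRing.injective A F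
  rw [map_zero, ← mul_one (algebraMap A F _), ← hδ, Finset.mul_sum,
    ← mul_zero (algebraMap A F (pderiv i h)), ← hδg, Finset.mul_sum]
  refine Finset.sum_congr rfl fun j _ => ?_
  rw [← mul_assoc, ← map_mul, hgh, map_mul]
  ring

/-- Let `ι₁, ι₂ : A → R` be two embeddings with the common retraction `d` and let the prime `Q` lie
in the kernel of `d`. If `h` is algebraic over `K[g]` and `ι₁ g ≡ ι₂ g` modulo `Q`, then
`ι₁ h ≡ ι₂ h` modulo `Q`. Indeed `ι₁ h - ι₂ h` is algebraic over `K[g]` in the domain `R ⧸ Q`. If it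
were nonzero it would satisfy an equation with nonzero constant term; applying `d`, which kills it,
gives an algebraic equation for `g` over `K`. -/
theorem dvd_sub_of_isAlgebraic {K A R : Type*} [Field K] [CommRing A] [IsDomain A] [Algebra K A]
    [CommRing R] [Algebra K R] {g h : A}
    (hg : Transcendental K g) {p : Polynomial (Polynomial K)} (hp : p ≠ 0)
    (hpe : p.eval₂ (Polynomial.aeval g : Polynomial K →ₐ[K] A).toRingHom h = 0)
    (ι₁ ι₂ : A →ₐ[K] R) (d : R →ₐ[K] A) (h₁ : d.comp ι₁ = AlgHom.id K A)
    (h₂ : d.comp ι₂ = AlgHom.id K A) {Q : R} (hQ : Prime Q) (hdQ : d Q = 0)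
    (hQg : Q ∣ ι₁ g - ι₂ g) : Q ∣ ι₁ h - ι₂ h := by
  let I := Ideal.span {Q}
  have : I.IsPrime := (Ideal.span_singleton_prime hQ.ne_zero).2 hQ
  let S := R ⧸ I
  let π : R →ₐ[K] S := Ideal.Quotient.mkₐ K I
  have hπ (r : R) : π r = 0 ↔ Q ∣ r := by
    rw [Ideal.Quotient.mkₐ_eq_mk, Ideal.Quotient.eq_zero_iff_mem, Ideal.mem_span_singleton]
  let dS : S →ₐ[K] A := Ideal.Quotient.liftₐ I d fun a ha => by
    obtain ⟨c, rfl⟩ := Ideal.mem_span_singleton.1 ha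
    simp [hdQ]
  have hdS (r : R) : dS (π r) = d r := rfl
  let γ : S := π (ι₁ g)
  have hγ : π (ι₂ g) = γ := (sub_eq_zero.1 (by rw [← map_sub]; exact (hπ _).2 hQg)).symm
  let _ : Algebra (Polynomial K) S := (Polynomial.aeval γ).toAlgebra
  have key (ι : A →ₐ[K] R) (hι : π (ι g) = γ) : IsAlgebraic (Polynomial K) (π (ι h)) := by
    refine ⟨p, hp, ?_⟩
    have := congrArg (π.comp ι).toRingHom hpe
    rw [map_zero, Polynomial.hom_eval₂] at this
    rw [← this, Polynomial.aeval_def]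
    have : (Polynomial.aeval γ : Polynomial K →ₐ[K] S) = (π.comp ι).comp (Polynomial.aeval g) := by
      ext; simp [hι]
    exact congrArg (fun f => Polynomial.eval₂ f (π (ι h)) p) (congrArg AlgHom.toRingHom this)
  rw [← hπ]
  by_contra hne
  obtain ⟨q, hq0, hq⟩ := ((key ι₁ rfl).sub (key ι₂ hγ)).exists_nonzero_coeff_and_aeval_eq_zero
    (mem_nonZeroDivisors_of_ne_zero (by rwa [← map_sub]))
  apply hq0
  apply (transcendental_iff_injective.1 hg)
  have h3 := congrArg dS.toRingHom hq
  have e1 : dS.toRingHom (π (ι₁ h) - π (ι₂ h)) = 0 := by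
    have a1 : d (ι₁ h) = h := DFunLike.congr_fun h₁ h
    have a2 : d (ι₂ h) = h := DFunLike.congr_fun h₂ h
    rw [map_sub, sub_eq_zero]
    exact a1.trans a2.symm
  rw [Polynomial.aeval_def, Polynomial.hom_eval₂, e1, Polynomial.eval₂_at_zero, map_zero] at h3
  have e2 : dS.comp (Polynomial.aeval γ) = Polynomial.aeval g := by
    ext
    rw [AlgHom.comp_apply, Polynomial.aeval_X, Polynomial.aeval_X]
    exact DFunLike.congr_fun h₁ g
  rw [map_zero, ← e2]
  exact h3

/-! ### Weighted degrees -/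

/-- The substitution `xₛ ↦ xₛ T ^ (w s)`. The coefficient of `T ^ m` in the image of `p` is the
weighted homogeneous component of `p` of weight `m`, so the `T`-degree of the image is the
`w`-degree of `p`. -/
noncomputable def weightHom {σ K : Type*} [CommRing K] (w : σ → ℕ) :
    MvPolynomial σ K →ₐ[K] Polynomial (MvPolynomial σ K) :=
  aeval fun s => Polynomial.C (X s) * Polynomial.X ^ w s

theorem weightHom_monomial {σ K : Type*} [CommRing K] (w : σ → ℕ) (d : σ →₀ ℕ) (a : K) :
    weightHom w (monomial d a) = Polynomial.monomial (Finsupp.weight w d) (monomial d a) := by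
  rw [weightHom, aeval_monomial, ← Polynomial.C_mul_X_pow_eq_monomial, monomial_eq,
    map_mul, map_finsuppProd, mul_assoc]
  congr 1
  simp only [mul_pow, Finsupp.prod_mul, Polynomial.C_pow, Finsupp.weight_apply, ← pow_mul]
  congr 1
  rw [Finsupp.prod, Finset.prod_pow_eq_pow_sum]
  simp [Finsupp.sum, mul_comm]

theorem weightHom_injective {σ K : Type*} [CommRing K] (w : σ → ℕ) :
    Function.Injective (weightHom (K := K) w) := by
  refine Function.LeftInverse.injective (g := Polynomial.aeval 1) fun p => ?_
  have : ((Polynomial.aeval (1 : MvPolynomial σ K)).restrictScalars K).comp (weightHom w) =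
      AlgHom.id K _ := by
    ext s; simp [weightHom]
  exact DFunLike.congr_fun this p

/-- On weighted homogeneous components, `∂/∂xₛ` lowers the weight by `w s`. -/
theorem coeff_weightHom_pderiv {σ K : Type*} [CommRing K] (w : σ → ℕ) (s : σ) (p : MvPolynomial σ K)
    (m : ℕ) : (weightHom w (pderiv s p)).coeff m = pderiv s ((weightHom w p).coeff (m + w s)) := by
  classical
  induction p using MvPolynomial.induction_on' with
  | add p q hp hq => simp [hp, hq]
  | monomial d a =>
    rw [pderiv_monomial, weightHom_monomial, weightHom_monomial]
    by_cases hd : d s = 0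
    · have : pderiv s (monomial d a) = 0 := by rw [pderiv_monomial, hd]; simp
      simp only [Polynomial.coeff_monomial]
      split_ifs <;> simp [this, hd]
    · have h1 : d - Finsupp.single s 1 + Finsupp.single s 1 = d :=
        tsub_add_cancel_of_le (by simpa using Nat.one_le_iff_ne_zero.2 hd)
      have h2 : Finsupp.weight w d = Finsupp.weight w (d - Finsupp.single s 1) + w s := by
        conv_lhs => rw [← h1]
        simp [Finsupp.weight_single]
      simp only [Polynomial.coeff_monomial, h2, Nat.add_right_cancel_iff]
      split_ifs <;> simp [pderiv_monomial]

theorem weightHom_rename {σ τ K : Type*} [CommRing K] (w : τ → ℕ) (f : σ → τ)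
    (p : MvPolynomial σ K) :
    weightHom w (rename f p) = (weightHom (w ∘ f) p).map (rename (R := K) f).toRingHom := by
  have : (weightHom w).comp (rename (R := K) f) =
      (Polynomial.mapAlgHom (rename (R := K) f)).comp (weightHom (w ∘ f)) := by
    ext s
    simp [weightHom]
  exact DFunLike.congr_fun this p

theorem weightHom_zero {σ K : Type*} [CommRing K] (p : MvPolynomial σ K) :
    weightHom 0 p = Polynomial.C p := by
  have : weightHom (σ := σ) (K := K) 0 =
      IsScalarTower.toAlgHom K (MvPolynomial σ K) (Polynomial (MvPolynomial σ K)) := by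
    ext s
    simp [weightHom]
  exact DFunLike.congr_fun this p

theorem weightHom_rename_of_comp_eq_zero {σ τ K : Type*} [CommRing K] {w : τ → ℕ} {f : σ → τ}
    (hw : w ∘ f = 0) (p : MvPolynomial σ K) :
    weightHom w (rename f p) = Polynomial.C (rename f p) := by
  rw [weightHom_rename, hw, weightHom_zero]
  simp

theorem pderiv_rename_of_notMem_range {σ τ K : Type*} [CommRing K] {f : σ → τ} {t : τ}
    (ht : t ∉ Set.range f) (p : MvPolynomial σ K) : pderiv t (rename f p) = 0 := by
  classical
  refine pderiv_eq_zero_of_notMem_vars fun h => ht ?_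
  obtain ⟨s, -, hs⟩ := Finset.mem_image.1 (vars_rename f p h)
  exact ⟨s, hs⟩

/-- A divisor of a nonzero polynomial involves only variables of that polynomial. -/
theorem pderiv_eq_zero_of_dvd_rename {σ τ K : Type*} [Field K] {f : σ → τ} {t : τ}
    (ht : t ∉ Set.range f) {p : MvPolynomial σ K} {q : MvPolynomial τ K} (hp : rename f p ≠ 0)
    (h : q ∣ rename f p) : pderiv t q = 0 := by
  classical
  obtain ⟨r, hr⟩ := h
  have hq : q ≠ 0 := fun h0 => hp (by rw [hr, h0, zero_mul])
  have hr0 : r ≠ 0 := fun h0 => hp (by rw [hr, h0, mul_zero])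
  have hdeg : degreeOf t (rename f p) = 0 := by
    rw [degreeOf_def, Multiset.count_eq_zero, ← Multiset.mem_toFinset, ← vars_def]
    intro h
    obtain ⟨s, -, hs⟩ := Finset.mem_image.1 (vars_rename f p h)
    exact ht ⟨s, hs⟩
  rw [hr, degreeOf_mul_eq hq hr0] at hdeg
  refine pderiv_eq_zero_of_notMem_vars fun h => ?_
  rw [vars_def, Multiset.mem_toFinset, ← Multiset.count_pos, ← degreeOf_def] at h
  omega

/-- A multiple of `Q` whose `w`-degree is smaller than that of `Q` is zero. -/
theorem eq_zero_of_dvd_of_coeff_weightHom {σ K : Type*} [Field K] (w : σ → ℕ)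
    {Q P : MvPolynomial σ K} (hQ : Q ≠ 0) (h : Q ∣ P)
    (hc : ∀ m, (weightHom w Q).natDegree ≤ m → (weightHom w P).coeff m = 0) : P = 0 := by
  apply weightHom_injective w
  rw [map_zero]
  refine Polynomial.eq_zero_of_dvd_of_degree_lt (map_dvd (weightHom w) h) ?_
  rw [Polynomial.degree_eq_natDegree ((map_ne_zero_iff _ (weightHom_injective w)).2 hQ)]
  exact (Polynomial.degree_lt_iff_coeff_zero _ _).2 hc

/-! ### Jacobians with vanishing minors -/

theorem exists_prime_dvd_of_map_eq_zero {A B : Type*} [CommRing A] [IsDomain A]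
    [UniqueFactorizationMonoid A] [CommRing B] [IsDomain B] (φ : A →+* B) {G : A} (hG : G ≠ 0)
    (h : φ G = 0) : ∃ Q, Prime Q ∧ Q ∣ G ∧ φ Q = 0 := by
  obtain ⟨f, hf, hfG⟩ := UniqueFactorizationMonoid.exists_prime_factors G hG
  have h0 : φ f.prod = 0 := by
    obtain ⟨u, hu⟩ := hfG
    rw [← hu, map_mul] at h
    exact (mul_eq_zero.1 h).resolve_right (u.isUnit.map φ).ne_zero
  rw [map_multiset_prod, Multiset.prod_eq_zero_iff, Multiset.mem_map] at h0
  obtain ⟨Q, hQ, hQ0⟩ := h0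
  exact ⟨Q, hf Q hQ, (Multiset.dvd_prod hQ).trans hfG.dvd, hQ0⟩

/-- If `JH · H = 0` and the `2 × 2` minors of the nonzero matrix `JH` vanish, then
`JH(x) · H(y) = 0` for independent `x` and `y`. -/
theorem sum_pderiv_inl_mul_inr_eq_zero {σ K : Type*} [Fintype σ] [Field K] [CharZero K]
    (H : σ → MvPolynomial σ K)
    (hker : ∀ k, ∑ j, pderiv j (H k) * H j = 0)
    (hrk : ∀ i j k l, pderiv i (H k) * pderiv j (H l) = pderiv j (H k) * pderiv i (H l))
    {i k : σ} (hik : pderiv i (H k) ≠ 0) (l : σ) :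
    ∑ j, rename (Sum.inl : σ → σ ⊕ σ) (pderiv j (H l)) * rename Sum.inr (H j) = 0 := by
  classical
  set g := H k
  let ι₁ : MvPolynomial σ K →ₐ[K] MvPolynomial (σ ⊕ σ) K := rename Sum.inl
  let ι₂ : MvPolynomial σ K →ₐ[K] MvPolynomial (σ ⊕ σ) K := rename Sum.inr
  let d : MvPolynomial (σ ⊕ σ) K →ₐ[K] MvPolynomial σ K := aeval (Sum.elim X X)
  have hd₁ : d.comp ι₁ = AlgHom.id K _ := by ext s; simp [d, ι₁]
  have hd₂ : d.comp ι₂ = AlgHom.id K _ := by ext s; simp [d, ι₂]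
  have hd₁' (p) : d (ι₁ p) = p := DFunLike.congr_fun hd₁ p
  have hd₂' (p) : d (ι₂ p) = p := DFunLike.congr_fun hd₂ p
  have hι₁ : Function.Injective ι₁ := rename_injective _ Sum.inl_injective
  have hι₂ : Function.Injective ι₂ := rename_injective _ Sum.inr_injective
  let G := ι₁ g - ι₂ g
  have hGl (j) : pderiv (Sum.inl j) G = ι₁ (pderiv j g) := by
    simp only [G, map_sub, ι₁, ι₂, pderiv_rename Sum.inl_injective,
      pderiv_rename_of_notMem_range (f := (Sum.inr : σ → σ ⊕ σ)) (t := Sum.inl j) (by simp),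
      sub_zero]
  have hGr (j) : pderiv (Sum.inr j) G = - ι₂ (pderiv j g) := by
    simp only [G, map_sub, ι₁, ι₂, pderiv_rename Sum.inr_injective,
      pderiv_rename_of_notMem_range (f := (Sum.inl : σ → σ ⊕ σ)) (t := Sum.inr j) (by simp),
      zero_sub]
  have hG0 : G ≠ 0 := fun h => by
    have := hGl i
    rw [h, map_zero] at this
    exact hik (hι₁ (by rw [← this, map_zero]))
  -- `Q` is the component of `g(x) = g(y)` that contains the diagonal, the zero set of the kernel of
  -- `d`.
  obtain ⟨Q, hQ, ⟨U, hU⟩, hdQ⟩ := exists_prime_dvd_of_map_eq_zero d.toRingHom hG0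
    (show d G = 0 by simp only [G, map_sub, hd₁', hd₂', sub_self])
  change d Q = 0 at hdQ
  have hGQ (s) : pderiv s G = pderiv s Q * U + Q * pderiv s U := by rw [hU, pderiv_mul]
  -- Restricting `∂G/∂xᵢ = ∂Q/∂xᵢ * U + Q * ∂U/∂xᵢ` to the diagonal shows that `Q` divides `G` only
  -- once.
  have hdU : d (pderiv (Sum.inl i) Q) * d U = pderiv i g := by
    have := congrArg d (hGQ (Sum.inl i))
    rw [hGl, hd₁'] at this
    simp [this, hdQ]
  have hQU : ¬ Q ∣ U := by
    rintro ⟨c, hc⟩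
    apply hik
    rw [← hdU, hc]
    simp [hdQ]
  have hQi : pderiv (Sum.inl i) Q ≠ 0 := fun h => hik (by rw [← hdU, h]; simp)
  have hdvd (m) : Q ∣ ι₁ (H m) - ι₂ (H m) := by
    obtain ⟨p, hp, hpe⟩ := isAlgebraic_of_pderiv_proportional (h := H m) hik
      (fun j => hrk i j k m)
    exact dvd_sub_of_isAlgebraic (transcendental_of_pderiv_ne_zero hik) hp hpe ι₁ ι₂ d hd₁ hd₂ hQ
      hdQ ⟨U, hU⟩
  -- The derivation `∑ⱼ Hⱼ(y) ∂/∂xⱼ` maps `G` into the ideal of `Q`, because `H(y) ≡ H(x)` modulo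
  -- `Q` and `JH · H = 0`. Hence it maps `Q` to a multiple of `Q`; as it lowers the `x`-degree, it
  -- kills `Q`.
  have hP : ∑ j, ι₂ (H j) * pderiv (Sum.inl j) Q = 0 := by
    refine eq_zero_of_dvd_of_coeff_weightHom (Sum.elim 1 0) hQ.ne_zero ?_ fun m hm => ?_
    · refine (hQ.dvd_or_dvd (b := U) ?_).resolve_right hQU
      have h1 : Q ∣ ∑ j, ι₂ (H j) * pderiv (Sum.inl j) G := by
        have h2 := congrArg ι₁ (hker k)
        rw [map_zero, map_sum] at h2
        rw [← sub_zero (Finset.sum _ _), ← h2, ← Finset.sum_sub_distrib]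
        refine Finset.dvd_sum fun j _ => ?_
        rw [hGl, map_mul, mul_comm, ← mul_sub, ← neg_sub]
        exact ((hdvd j).neg_right).mul_left _
      have h3 : ∑ j, ι₂ (H j) * pderiv (Sum.inl j) G =
          (∑ j, ι₂ (H j) * pderiv (Sum.inl j) Q) * U +
            Q * ∑ j, ι₂ (H j) * pderiv (Sum.inl j) U := by
        rw [Finset.sum_mul, Finset.mul_sum, ← Finset.sum_add_distrib]
        refine Finset.sum_congr rfl fun j _ => ?_
        rw [hGQ]
        ring
      rw [h3] at h1
      exact (dvd_add_left (dvd_mul_right _ _)).1 h1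
    · rw [map_sum, Polynomial.finsetSum_coeff]
      refine Finset.sum_eq_zero fun j _ => ?_
      rw [map_mul, weightHom_rename_of_comp_eq_zero (by rfl), Polynomial.coeff_C_mul,
        coeff_weightHom_pderiv, Polynomial.coeff_eq_zero_of_natDegree_lt (by simp; omega), map_zero,
        mul_zero]
  -- The leading form of `Q` with respect to `y` divides that of `g(x) - g(y)`, which is free of
  -- `x`.
  have hlead (j) : pderiv (Sum.inl j) (weightHom (Sum.elim 0 1) Q).leadingCoeff = 0 := by
    have hdeg : (weightHom (Sum.elim 0 1) G).natDegree ≠ 0 := by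
      intro h
      have h0 : pderiv (Sum.inr i) G = 0 := by
        apply weightHom_injective (Sum.elim 0 1)
        ext1 m
        rw [coeff_weightHom_pderiv, Polynomial.coeff_eq_zero_of_natDegree_lt (by simp [h])]
        simp
      rw [hGr, neg_eq_zero] at h0
      exact hik (hι₂ (by rw [h0, map_zero]))
    obtain ⟨p, hlc⟩ : ∃ p, (weightHom (Sum.elim 0 1) G).leadingCoeff =
        rename (Sum.inr : σ → σ ⊕ σ) p := by
      refine ⟨-(weightHom (Sum.elim 0 1 ∘ (Sum.inr : σ → σ ⊕ σ)) g).coeff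
        (weightHom (Sum.elim 0 1) G).natDegree, ?_⟩
      rw [Polynomial.leadingCoeff]
      generalize (weightHom (Sum.elim 0 1) G).natDegree = N at hdeg
      simp only [G, map_sub, ι₁, ι₂]
      rw [weightHom_rename_of_comp_eq_zero (by rfl), weightHom_rename, Polynomial.coeff_sub,
        Polynomial.coeff_C_of_ne_zero hdeg, Polynomial.coeff_map, map_neg, zero_sub]
      rfl
    refine pderiv_eq_zero_of_dvd_rename (f := (Sum.inr : σ → σ ⊕ σ)) (p := p) (by simp) ?_ ?_
    · rw [← hlc]
      exact Polynomial.leadingCoeff_ne_zero.2 ((map_ne_zero_iff _ (weightHom_injective _)).2 hG0)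
    · rw [← hlc, hU, map_mul, Polynomial.leadingCoeff_mul]
      exact dvd_mul_right _ _
  -- The derivation `∂ᵢg(x) ∂/∂xⱼ - ∂ⱼg(x) ∂/∂xᵢ` kills `G`, hence maps `Q` to a multiple of `Q`. It
  -- lowers the `y`-degree of `Q`, because it kills the leading form; so it kills `Q`.
  have hE (j) : ι₁ (pderiv i g) * pderiv (Sum.inl j) Q -
      ι₁ (pderiv j g) * pderiv (Sum.inl i) Q = 0 := by
    refine eq_zero_of_dvd_of_coeff_weightHom (Sum.elim 0 1) hQ.ne_zero ?_ fun m hm => ?_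
    · refine (hQ.dvd_or_dvd (b := U) ?_).resolve_right hQU
      refine ⟨ι₁ (pderiv j g) * pderiv (Sum.inl i) U - ι₁ (pderiv i g) * pderiv (Sum.inl j) U, ?_⟩
      have h1 := hGQ (Sum.inl i)
      have h2 := hGQ (Sum.inl j)
      rw [hGl] at h1 h2
      linear_combination ι₁ (pderiv j g) * h1 - ι₁ (pderiv i g) * h2
    · have hm0 (j) : pderiv (Sum.inl j) ((weightHom (Sum.elim 0 1) Q).coeff m) = 0 := by
        rcases hm.eq_or_lt with rfl | hlt
        · exact hlead j
        · rw [Polynomial.coeff_eq_zero_of_natDegree_lt hlt, map_zero]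
      simp only [map_sub, map_mul, ι₁]
      rw [weightHom_rename_of_comp_eq_zero (by rfl), weightHom_rename_of_comp_eq_zero (by rfl),
        Polynomial.coeff_sub, Polynomial.coeff_C_mul, Polynomial.coeff_C_mul,
        coeff_weightHom_pderiv, coeff_weightHom_pderiv]
      simp [hm0]
  -- The `x`-gradients of `Q` and `g(x)` are proportional and the first is orthogonal to `H(y)`.
  have hDg : ∑ j, ι₁ (pderiv j g) * ι₂ (H j) = 0 := by
    refine (mul_eq_zero.1 ?_).resolve_left hQi
    rw [Finset.mul_sum, ← mul_zero (ι₁ (pderiv i g)), ← hP, Finset.mul_sum]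
    refine Finset.sum_congr rfl fun j _ => ?_
    linear_combination (- ι₂ (H j)) * hE j
  refine (mul_eq_zero.1 ?_).resolve_left ((map_ne_zero_iff _ hι₁).2 hik)
  rw [← mul_zero (ι₁ (pderiv i (H l))), ← hDg, Finset.mul_sum, Finset.mul_sum]
  refine Finset.sum_congr rfl fun j _ => ?_
  have := congrArg ι₁ (hrk i j k l)
  rw [map_mul, map_mul] at this
  change _ * (ι₁ _ * ι₂ _) = _
  linear_combination ι₂ (H j) * this

/-! ### Quasi-translations -/

/-- A quasi-translation satisfies `H(x + mH) = H` for all natural numbers `m`. -/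
theorem IsQuasiTranslation.bind₁_add_nsmul {n : ℕ} {R : Type*} [CommRing R] {H : PolyMap n R}
    (hH : IsQuasiTranslation H) (k : Fin n) (m : ℕ) :
    bind₁ (fun i => X i + m • H i) (H k) = H k := by
  -- From `(x - H) ∘ (x + H) = x`.
  have h1 (i : Fin n) : bind₁ (idMap n R + H) (H i) = H i := by
    have := congrFun hH.2 i
    simp only [comp, idMap, Pi.sub_apply, map_sub, bind₁_X_right, Pi.add_apply] at this
    exact (by linear_combination -this : bind₁ (idMap n R + H) (H i) = H i)
  induction m with
  | zero => simp [bind₁_X_left]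
  | succ m ih =>
    have h2 : (fun i => X i + (m + 1) • H i) =
        fun i => bind₁ (idMap n R + H) (X i + m • H i) := by
      funext i
      simp only [map_add, map_nsmul, h1, bind₁_X_right, Pi.add_apply, idMap]
      rw [add_smul, one_smul]
      ring
    rw [h2, ← bind₁_bind₁, ih, h1]

/-- A quasi-translation satisfies `JH · H = 0`: in characteristic zero the identities
`H(x + mH) = H` force `H(x + tH) = H` for an indeterminate `t`, and `JH · H` is the derivative of
the left-hand side at `t = 0`. -/
theorem IsQuasiTranslation.jacobian_mul_self {n : ℕ} {K : Type*} [Field K] [CharZero K]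
    {H : PolyMap n K} (hH : IsQuasiTranslation H) (k : Fin n) :
    ∑ j, pderiv j (H k) * H j = 0 := by
  let A := MvPolynomial (Fin n) K
  let f : Fin n → Polynomial A := fun i => Polynomial.C (X i) + Polynomial.X * Polynomial.C (H i)
  have hev (m : A) (p : A) : (aeval f p).eval m = bind₁ (fun i => X i + m * H i) p := by
    have : ((Polynomial.aeval m).restrictScalars K).comp (aeval f) =
        bind₁ (fun i => X i + m * H i) := by
      ext1 s
      rw [bind₁_X_right]
      simp [f]
      ring
    simpa using DFunLike.congr_fun this p
  have hconst : aeval f (H k) = Polynomial.C (H k) := by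
    refine Polynomial.eq_of_infinite_eval_eq _ _ ?_
    refine (Set.infinite_range_of_injective (Nat.cast_injective (R := A))).mono ?_
    rintro _ ⟨m, rfl⟩
    simp only [Set.mem_ofPred_eq, hev, Polynomial.eval_C, ← nsmul_eq_mul]
    exact hH.bind₁_add_nsmul k m
  have hder := derivation_aeval_eq_sum ((Polynomial.derivative' (R := A)).restrictScalars K) f (H k)
  rw [hconst] at hder
  have h0 := congrArg (Polynomial.eval 0) hder
  simp only [Polynomial.eval_finsetSum, smul_eq_mul, Polynomial.eval_mul, hev] at h0
  simpa [f, bind₁_X_left] using h0.symm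

theorem jacobian_ne_zero_of_degree_ne_zero {n : ℕ} {K : Type*} [Field K] [CharZero K]
    {H : PolyMap n K} (h : degree H ≠ 0) : jacobian H ≠ 0 := by
  intro hJ
  apply h
  rw [degree, ← Nat.bot_eq_zero, Finset.sup_eq_bot_iff]
  intro i _
  rw [Nat.bot_eq_zero, totalDegree_eq_zero_iff]
  intro m hm j
  by_contra hmj
  have h1 := congrArg (coeff (m - Finsupp.single j 1)) (congrFun (congrFun hJ i) j)
  have h2 : m - Finsupp.single j 1 + Finsupp.single j 1 = m :=
    tsub_add_cancel_of_le (by simpa using Nat.one_le_iff_ne_zero.2 hmj)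
  simp only [jacobian, Matrix.of_apply, coeff_pderiv, h2, Matrix.zero_apply, coeff_zero] at h1
  exact (mul_ne_zero (mem_support_iff.1 hm) (Nat.cast_add_one_ne_zero _)) h1

theorem exists_pderiv_eq_C {n : ℕ} {K : Type*} [Field K]
    {H : PolyMap n K} (h : degree H = 1) (k j : Fin n) : ∃ a, pderiv j (H k) = C a := by
  refine ⟨coeff 0 (pderiv j (H k)), ?_⟩
  rw [← totalDegree_eq_zero_iff_eq_C]
  have h1 : (H k).totalDegree ≤ 1 := h ▸ Finset.le_sup (f := fun i => (H i).totalDegree)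
    (Finset.mem_univ k)
  rw [totalDegree_eq_zero_iff]
  intro m hm i
  by_contra hmi
  rw [mem_support_iff, coeff_pderiv] at hm
  refine hm ?_
  rw [coeff_eq_zero_of_totalDegree_lt, zero_mul]
  refine h1.trans_lt ?_
  have := map_add Finsupp.degree m (Finsupp.single j 1)
  rw [Finsupp.degree_single] at this
  have h2 := Finsupp.le_degree i m
  change 1 < (m + Finsupp.single j 1).degree
  omega

/-! ### Rank and strong nilpotency index -/

theorem minor_eq_of_rank_eq_one {n : Type*} [Fintype n] {F : Type*} [Field F]
    {M : Matrix n n F} (h : M.rank = 1) (i j k l : n) : M k i * M l j = M k j * M l i := by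
  classical
  obtain ⟨v, -, hv⟩ := finrank_eq_one_iff'.1 h
  have hcol (j : n) : ∃ c : F, ∀ k, M k j = c * v.1 k := by
    obtain ⟨c, hc⟩ := hv ⟨M.mulVecLin (Pi.single j 1), LinearMap.mem_range_self _ _⟩
    refine ⟨c, fun k => ?_⟩
    have := congrFun (congrArg Subtype.val hc) k
    simpa using this.symm
  obtain ⟨a, ha⟩ := hcol i
  obtain ⟨b, hb⟩ := hcol j
  rw [ha, ha, hb, hb]
  ring

theorem minor_eq_of_polyRank_eq_one {m n : ℕ} {K : Type*} [Field K]
    {M : Matrix (Fin m) (Fin m) (MvPolynomial (Fin n) K)} (h : polyRank M = 1) (i j k l : Fin m) :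
    M k i * M l j = M k j * M l i := by
  apply IsFractionRing.injective (MvPolynomial (Fin n) K) (FractionRing (MvPolynomial (Fin n) K))
  simpa using minor_eq_of_rank_eq_one h i j k l

theorem hasStrongNilpotencyIndex_two {m n : ℕ} {R : Type*} [CommRing R]
    {M : Matrix (Fin m) (Fin m) (MvPolynomial (Fin n) R)} (hM : M ≠ 0)
    (h : M.map (rename (Sum.inl : Fin n → Fin n ⊕ Fin n)) * M.map (rename Sum.inr) = 0) :
    HasStrongNilpotencyIndex M 2 := by
  refine ⟨?_, fun s hs => ?_⟩
  · let φ : MvPolynomial (Fin n ⊕ Fin n) R →ₐ[R] MvPolynomial (Fin 2 × Fin n) R :=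
      rename (Sum.elim (fun j => (0, j)) (fun j => (1, j)))
    have := congrArg (fun A => A.map φ) h
    simp only [Matrix.map_mul, Matrix.map_map] at this
    rw [Matrix.map_zero _ (map_zero φ)] at this
    rw [Set.mem_ofPred_eq, substProd, ← this]
    simp [List.ofFn_succ]
    congr 2 <;> ext1 p <;> simp [φ, rename_rename]
  · by_contra hlt
    have h2 : s = 0 ∨ s = 1 := by omega
    rcases h2 with rfl | rfl
    -- If `1 = 0` among the matrices of size `m` over `R[∅]`, then `M = 0`.
    · apply hM
      have h1 : (1 : Matrix (Fin m) (Fin m) (MvPolynomial (Fin 0 × Fin n) R)) = 0 := by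
        simpa [substProd] using hs
      ext1 i j
      have h3 := congrArg
        (aeval fun s : Fin 0 × Fin n => (s.1.elim0 : MvPolynomial (Fin n) R))
        (congrFun (congrFun h1 i) i)
      simp only [Matrix.one_apply_eq, Matrix.zero_apply, map_one, map_zero] at h3
      exact eq_of_zero_eq_one h3.symm _ _
    · apply hM
      have h1 : M.map (rename fun j : Fin n => ((0 : Fin 1), j)) = 0 := by
        simpa [substProd, List.ofFn_succ] using hs
      ext1 i j
      refine rename_injective _ (Prod.mk_right_injective (0 : Fin 1)) ?_
      simpa using congrFun (congrFun h1 i) j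

theorem jacobian_ne_zero {n : ℕ} {K : Type*} [Field K] [CharZero K] {H : PolyMap n K}
    (h : degree H = 1 ∨ polyRank (jacobian H) = 1) : jacobian H ≠ 0 := by
  rcases h with h | h
  · exact jacobian_ne_zero_of_degree_ne_zero (by omega)
  · intro h0
    rw [h0, polyRank, Matrix.map_zero _ (map_zero _), Matrix.rank_zero] at h
    omega

theorem IsQuasiTranslation.jacobian_inl_mul_jacobian_inr {n : ℕ} {K : Type*} [Field K] [CharZero K]
    {H : PolyMap n K} (hH : IsQuasiTranslation H)
    (h : degree H = 1 ∨ polyRank (jacobian H) = 1) :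
    (jacobian H).map (rename (Sum.inl : Fin n → Fin n ⊕ Fin n)) *
      (jacobian H).map (rename (Sum.inr : Fin n → Fin n ⊕ Fin n)) = 0 := by
  have hJ := jacobian_ne_zero h
  have hker := hH.jacobian_mul_self
  have hvec (k : Fin n) : ∑ j, rename (Sum.inl : Fin n → Fin n ⊕ Fin n) (pderiv j (H k)) *
      rename Sum.inr (H j) = 0 := by
    rcases h with h | h
    -- In degree one, `JH(x) = JH(y)` is constant and `JH(y) · H(y) = 0`.
    · have := congrArg (rename (Sum.inr : Fin n → Fin n ⊕ Fin n)) (hker k)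
      rw [map_zero, map_sum] at this
      rw [← this]
      refine Finset.sum_congr rfl fun j _ => ?_
      obtain ⟨a, ha⟩ := exists_pderiv_eq_C h k j
      simp [ha]
    · obtain ⟨k₀, i, hki⟩ : ∃ k i, pderiv i (H k) ≠ 0 := by
        by_contra! h0
        exact hJ (by ext1 k i; exact h0 k i)
      exact sum_pderiv_inl_mul_inr_eq_zero H hker
        (fun i j k l => minor_eq_of_polyRank_eq_one h i j k l) hki k
  ext1 k m
  have := congrArg (pderiv (Sum.inr m)) (hvec k)
  rw [map_zero, map_sum] at this
  rw [Matrix.mul_apply, Matrix.zero_apply, ← this]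
  refine Finset.sum_congr rfl fun j _ => ?_
  rw [pderiv_mul, pderiv_rename_of_notMem_range (by simp), pderiv_rename Sum.inr_injective,
    zero_mul, zero_add]
  rfl

end QuasiTrans

theorem mainTheorem9 {K : Type*} [Field K] [CharZero K] {n : ℕ}
    (H : QuasiTrans.PolyMap n K) (hH : QuasiTrans.IsQuasiTranslation H)
    (h : QuasiTrans.degree H = 1 ∨ QuasiTrans.polyRank (QuasiTrans.jacobian H) = 1) :
    QuasiTrans.HasStrongNilpotencyIndex (QuasiTrans.jacobian H) 2 ∧
      (QuasiTrans.jacobian H).map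
          (MvPolynomial.rename (Sum.inl : Fin n → Fin n ⊕ Fin n)) *
        (QuasiTrans.jacobian H).map
          (MvPolynomial.rename (Sum.inr : Fin n → Fin n ⊕ Fin n)) = 0 :=
  have hprod := hH.jacobian_inl_mul_jacobian_inr h
  ⟨QuasiTrans.hasStrongNilpotencyIndex_two (QuasiTrans.jacobian_ne_zero h) hprod, hprod⟩
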